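/- Consider a trial-offer market with $N\ge 1$ items and $K\ge 1$ classes of consumers that follows a mixed multinomial logit (MMNL) model. Its data are arrival rates $\lambda_k>0$, giving class weights $w_k=\lambda_k/\sum_{l}\lambda_l$; visibilities $v_1\ge v_2\ge\dots\ge v_N\ge 0$ of the positions, with $v_1>0$; appeals $a_{i,k}>0$; qualities $q_{i,k}\in[0,1]$, not all zero; and a constant $z\ge 0$. Consumers arrive one at a time. Each one is of class $k$ with probability $w_k$, independently of the past. If she is of class $k$, the items are placed according to a permutation $\sigma$ (item $i$ in position $\sigma(i)$) and the popularity vector $s\in\mathbb N^N$ is displayed, then she tries item $i$ with probability $$p_{i,k}(\sigma,s)=\frac{v_{\sigma(i)}(a_{i,k}+s_i)}{\sum_{j=1}^N v_{\sigma(j)}(a_{j,k}+s_j)+z}$$ (at most one item is tried), and she buys the tried item with probability $q_{i,k}$. Let $d^t\in\mathbb N^N$ be the vector of the numbers of purchases of each item before time $t$, with $d^0=0$. With the global popularity signal the displayed vector at time $t$ is $s=d^t$; without the signal it is always $s=0$. The weighted average quality of item $i$ is $\bar q_i=\sum_{k}w_kq_{i,k}$. Let $\sigma$ be an average quality ranking,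 that is, a fixed permutation that orders the items by decreasing $\bar q_i$ (ties broken arbitrarily). Let $P^t_{AQGSI}$ and $P^t_{AQNSI}$ be the probabilities that the consumer arriving at time $t$ makes a purchase under the ranking $\sigma$, with the global popularity signal and without it, respectively. Then the limits $P_{AQGSI}=\lim_{t\to\infty}P^t_{AQGSI}$ and $P_{AQNSI}=\lim_{t\to\infty}P^t_{AQNSI}$ exist, $$P_{AQGSI}=\max_{1\le i\le N}\bar q_i>0,\qquad P_{AQNSI}=\sum_{k=1}^K w_k\sum_{i=1}^N q_{i,k}\frac{v_{\sigma(i)}a_{i,k}}{\sum_{j=1}^N v_{\sigma(j)}a_{j,k}+z},$$ with the signal also the conditional purchase probability $\sum_k w_k\sum_i p_{i,k}(\sigma,d^t)\,q_{i,k}$ given $d^t$ converges to $P_{AQGSI}$ almost surely, and $$0\le \frac{P_{AQNSI}}{P_{AQGSI}}\le K .$$ That is, under the average quality ranking the market can do at most $K$ times better without the popularity signal than with it. -/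

import Mathlib

open MeasureTheory ProbabilityTheory Filter Topology

/-- The data of a trial-offer market with `N` items and `K` classes of consumers whose
preferences follow a mixed multinomial logit (MMNL) model. -/
structure MMNLMarket (N K : ℕ) where
  /-- arrival rate of the consumers of class `k` -/
  rate : Fin K → ℝ
  rate_pos : ∀ k, 0 < rate k
  /-- there is at least one class of consumers -/
  K_pos : 0 < K
  /-- visibility of position `j`; the positions are sorted by decreasing visibility -/
  v : Fin N → ℝ
  v_nonneg : ∀ j, 0 ≤ v j
  v_antitone : Antitone v
  /-- intrinsic appeal of item `i` for class `k` -/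
  a : Fin N → Fin K → ℝ
  a_pos : ∀ i k, 0 < a i k
  /-- quality: probability that a consumer of class `k` who has tried item `i` buys it -/
  q : Fin N → Fin K → ℝ
  q_nonneg : ∀ i k, 0 ≤ q i k
  q_le_one : ∀ i k, q i k ≤ 1
  /-- constant weight of trying nothing -/
  z : ℝ
  z_nonneg : 0 ≤ z

namespace MMNLMarket

noncomputable section

variable {N K : ℕ} (M : MMNLMarket N K)

/-- The weight `w k` of class `k`: the probability that the next consumer is of class `k`. -/
def w (k : Fin K) : ℝ := M.rate k / ∑ l, M.rate l

/-- The weighted average quality of item `i`. -/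
def avgQuality (i : Fin N) : ℝ := ∑ k, M.w k * M.q i k

/-- `σ` (item `i` is placed in position `σ i`) orders the items by decreasing weighted average
quality; items of equal average quality may be placed in any order. -/
def IsAverageQualityRanking (σ : Equiv.Perm (Fin N)) : Prop :=
  ∀ i j, M.avgQuality j < M.avgQuality i → σ i < σ j

/-- The probability that a consumer of class `k`, facing the ranking `σ` and the displayed
popularity vector `s`, tries item `i`. -/
def tryProb (σ : Equiv.Perm (Fin N)) (s : Fin N → ℕ) (i : Fin N) (k : Fin K) : ℝ :=
  M.v (σ i) * (M.a i k + s i) / (∑ j, M.v (σ j) * (M.a j k + s j) + M.z)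

/-- The probability that the next consumer, facing the ranking `σ` and the displayed popularity
vector `s`, makes a purchase. -/
def purchaseProb (σ : Equiv.Perm (Fin N)) (s : Fin N → ℕ) : ℝ :=
  ∑ k, M.w k * ∑ i, M.tryProb σ s i k * M.q i k

theorem w_nonneg (k : Fin K) : 0 ≤ M.w k :=
  div_nonneg (M.rate_pos k).le (Finset.sum_nonneg fun l _ => (M.rate_pos l).le)

theorem sum_w : ∑ k, M.w k = 1 := by
  have : Nonempty (Fin K) := ⟨⟨0, M.K_pos⟩⟩
  have h : 0 < ∑ l, M.rate l :=
    Finset.sum_pos (fun l _ => M.rate_pos l) Finset.univ_nonempty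
  simp only [w, ← Finset.sum_div]
  exact div_self h.ne'

theorem tryNum_nonneg (σ : Equiv.Perm (Fin N)) (s : Fin N → ℕ) (i : Fin N) (k : Fin K) :
    0 ≤ M.v (σ i) * (M.a i k + s i) :=
  mul_nonneg (M.v_nonneg _) (add_nonneg (M.a_pos i k).le (Nat.cast_nonneg _))

theorem tryProb_nonneg (σ : Equiv.Perm (Fin N)) (s : Fin N → ℕ) (i : Fin N) (k : Fin K) :
    0 ≤ M.tryProb σ s i k :=
  div_nonneg (M.tryNum_nonneg σ s i k)
    (add_nonneg (Finset.sum_nonneg fun j _ => M.tryNum_nonneg σ s j k) M.z_nonneg)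

theorem sum_tryProb_le_one (σ : Equiv.Perm (Fin N)) (s : Fin N → ℕ) (k : Fin K) :
    ∑ i, M.tryProb σ s i k ≤ 1 := by
  simp only [tryProb, ← Finset.sum_div]
  exact div_le_one_of_le₀ (le_add_of_nonneg_right M.z_nonneg)
    (add_nonneg (Finset.sum_nonneg fun j _ => M.tryNum_nonneg σ s j k) M.z_nonneg)

/-- The law of the class of an arriving consumer. -/
def classLaw : PMF (Fin K) :=
  PMF.ofFintype (fun k => ENNReal.ofReal (M.w k)) (by
    rw [← ENNReal.ofReal_sum_of_nonneg fun k _ => M.w_nonneg k, M.sum_w, ENNReal.ofReal_one])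

/-- The law of the item tried by a consumer of class `k` facing the ranking `σ` and the displayed
popularity vector `s`; `none` means that she tries nothing. -/
def trialLaw (σ : Equiv.Perm (Fin N)) (s : Fin N → ℕ) (k : Fin K) : PMF (Option (Fin N)) :=
  PMF.ofFintype
    (fun o => o.elim (ENNReal.ofReal (1 - ∑ i, M.tryProb σ s i k))
      (fun i => ENNReal.ofReal (M.tryProb σ s i k))) (by
    rw [Fintype.sum_option]
    simp only [Option.elim]
    rw [← ENNReal.ofReal_sum_of_nonneg fun i _ => M.tryProb_nonneg σ s i k,
      ← ENNReal.ofReal_add (sub_nonneg.2 (M.sum_tryProb_le_one σ s k))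
        (Finset.sum_nonneg fun i _ => M.tryProb_nonneg σ s i k),
      sub_add_cancel, ENNReal.ofReal_one])

/-- The law of the decision (`true`: buy) of a consumer of class `k` who has tried item `i`. -/
def buyLaw (i : Fin N) (k : Fin K) : PMF Bool :=
  PMF.ofFintype
    (fun b => cond b (ENNReal.ofReal (M.q i k)) (ENNReal.ofReal (1 - M.q i k))) (by
    rw [Fintype.sum_bool]
    simp only [cond_true, cond_false]
    rw [← ENNReal.ofReal_add (M.q_nonneg i k) (sub_nonneg.2 (M.q_le_one i k)),
      add_sub_cancel, ENNReal.ofReal_one])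

/-- The law of the next sales vector, when `d` is the current sales vector, `σ` the ranking and
`s` the displayed popularity vector: a consumer arrives, tries at most one item, and the sales
of that item increase by one if she buys it. -/
def stepLaw (σ : Equiv.Perm (Fin N)) (s d : Fin N → ℕ) : PMF (Fin N → ℕ) :=
  M.classLaw.bind fun k =>
    (M.trialLaw σ s k).bind fun o =>
      match o with
      | none => PMF.pure d
      | some i => (M.buyLaw i k).map fun b => cond b (d + Pi.single i 1) d

/-- The transition kernel from the history `d⁰, …, dᵗ` of the sales vectors to `dᵗ⁺¹`. The ranking
`σ` is static, and `signal d` is what is displayed to the consumers when the sales vector is `d`. -/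
def transition (σ : Equiv.Perm (Fin N)) (signal : (Fin N → ℕ) → (Fin N → ℕ)) (t : ℕ) :
    Kernel ((i : Finset.Iic t) → (fun _ : ℕ => Fin N → ℕ) i) (Fin N → ℕ) :=
  Kernel.ofFunOfCountable fun h =>
    (M.stepLaw σ (signal (h ⟨t, Finset.mem_Iic.2 le_rfl⟩))
      (h ⟨t, Finset.mem_Iic.2 le_rfl⟩)).toMeasure

instance (σ : Equiv.Perm (Fin N)) (signal : (Fin N → ℕ) → (Fin N → ℕ)) (t : ℕ) :
    IsMarkovKernel (M.transition σ signal t) :=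
  ⟨fun _ => PMF.toMeasure.isProbabilityMeasure _⟩

/-- The law of the whole run `d⁰, d¹, d², …` of the market, started without any past purchase. -/
def runLaw (σ : Equiv.Perm (Fin N)) (signal : (Fin N → ℕ) → (Fin N → ℕ)) :
    Measure (ℕ → Fin N → ℕ) :=
  Kernel.traj (X := fun _ => Fin N → ℕ) (M.transition σ signal) 0 (fun _ => 0)

/-- The global popularity signal: the vector of past purchases is displayed. -/
def globalSignal (d : Fin N → ℕ) : Fin N → ℕ := d

/-- No popularity signal: the zero vector takes the place of the vector of past purchases. -/
def noSignal (_ : Fin N → ℕ) : Fin N → ℕ := 0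

/-- The probability that the consumer who arrives at time `t` makes a purchase. -/
def purchaseProbAt (σ : Equiv.Perm (Fin N)) (signal : (Fin N → ℕ) → (Fin N → ℕ)) (t : ℕ) : ℝ :=
  (M.runLaw σ signal).real {d | d (t + 1) ≠ d t}

end

end MMNLMarket

/-! Let `m` be the item in the top position; it maximizes both visibility and average quality. With
the signal the sales vector is an urn process, analysed in three steps.

The chance of selling `m` at time `t` is at least of order `1 / t`, because at most `t` sales
occurred before. The harmonic series diverges, so conditional Borel-Cantelli gives infinitely many
sales of `m` (`ae_tendsto_sales`).

If `j` has smaller average quality, pick `η < 1` above the ratio of the two average qualities. Once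
`m` has sold enough, `(d j + const) * (d m) ^ (-η)` has nonpositive drift, so it is a nonnegative
supermartingale and converges. Multiplying by `(d m) ^ (-(1 - η))` yields `d j / d m → 0`
(`ae_tendsto_sales_div_sales`).

For large sales the appeals no longer matter: every class tries item `i` with nearly the same
probability, so the purchase probability is nearly a weighted mean of average qualities. The weights
settle on items of maximal average quality; how tied items share them is irrelevant
(`tendsto_purchaseProb`). Bounded convergence passes to expectations. Without the signal the
purchase probability is constant in time, and the factor `K` comes from bounding each class
separately. -/

/-! ### Finite mixtures and the law of one step -/

theorem PMF.toMeasure_bind_fintype {α β : Type*} [Fintype α] [MeasurableSpace β]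
    (p : PMF α) (f : α → PMF β) :
    (p.bind f).toMeasure = ∑ a, p a • (f a).toMeasure := by
  ext s hs
  rw [PMF.toMeasure_bind_apply _ _ _ hs, tsum_fintype]
  simp

theorem PMF.integrable_bind_fintype {α β : Type*} [Fintype α] [MeasurableSpace β]
    {p : PMF α} {f : α → PMF β} {g : β → ℝ} (hg : ∀ a, Integrable g (f a).toMeasure) :
    Integrable g (p.bind f).toMeasure := by
  rw [PMF.toMeasure_bind_fintype]
  exact integrable_finsetSum_measure.2 fun a _ => (hg a).smul_measure (p.apply_ne_top a)

theorem PMF.integral_bind_fintype {α β : Type*} [Fintype α] [MeasurableSpace β]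
    {p : PMF α} {f : α → PMF β} {g : β → ℝ} (hg : ∀ a, Integrable g (f a).toMeasure) :
    ∫ x, g x ∂(p.bind f).toMeasure = ∑ a, (p a).toReal * ∫ x, g x ∂(f a).toMeasure := by
  rw [PMF.toMeasure_bind_fintype,
    integral_finsetSum_measure fun a _ => (hg a).smul_measure (p.apply_ne_top a)]
  simp [integral_smul_measure]

namespace MMNLMarket

variable {N K : ℕ} (M : MMNLMarket N K)

/-- The probability that the next consumer, facing the ranking `σ` and the displayed popularity
vector `s`, purchases item `i`. -/
noncomputable def buyProb (σ : Equiv.Perm (Fin N)) (s : Fin N → ℕ) (i : Fin N) : ℝ :=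
  ∑ k, M.w k * (M.tryProb σ s i k * M.q i k)

theorem buyProb_nonneg (σ : Equiv.Perm (Fin N)) (s : Fin N → ℕ) (i : Fin N) :
    0 ≤ M.buyProb σ s i :=
  Finset.sum_nonneg fun k _ =>
    mul_nonneg (M.w_nonneg k) (mul_nonneg (M.tryProb_nonneg σ s i k) (M.q_nonneg i k))

theorem purchaseProb_eq_sum_buyProb (σ : Equiv.Perm (Fin N)) (s : Fin N → ℕ) :
    M.purchaseProb σ s = ∑ i, M.buyProb σ s i := by
  simp only [purchaseProb, buyProb, Finset.mul_sum]
  exact Finset.sum_comm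

theorem purchaseProb_nonneg (σ : Equiv.Perm (Fin N)) (s : Fin N → ℕ) :
    0 ≤ M.purchaseProb σ s := by
  rw [purchaseProb_eq_sum_buyProb]
  exact Finset.sum_nonneg fun i _ => M.buyProb_nonneg σ s i

theorem purchaseProb_le_one (σ : Equiv.Perm (Fin N)) (s : Fin N → ℕ) :
    M.purchaseProb σ s ≤ 1 := by
  rw [← M.sum_w]
  refine Finset.sum_le_sum fun k _ => mul_le_of_le_one_right (M.w_nonneg k) ?_
  refine le_trans (Finset.sum_le_sum fun i _ => ?_) (M.sum_tryProb_le_one σ s k)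
  exact mul_le_of_le_one_right (M.tryProb_nonneg σ s i k) (M.q_le_one i k)

/-- The law of the next sales vector, given the trial of a consumer of class `k`. -/
noncomputable def trialStep (k : Fin K) (d : Fin N → ℕ) (o : Option (Fin N)) :
    PMF (Fin N → ℕ) :=
  match o with
  | none => PMF.pure d
  | some i => (M.buyLaw i k).map fun b => cond b (d + Pi.single i 1) d

theorem trialStep_toMeasure_none (k : Fin K) (d : Fin N → ℕ) :
    (M.trialStep k d none).toMeasure = Measure.dirac d := by
  simp [trialStep, PMF.toMeasure_pure]

theorem trialStep_toMeasure_some (k : Fin K) (d : Fin N → ℕ) (i : Fin N) :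
    (M.trialStep k d (some i)).toMeasure =
      ENNReal.ofReal (M.q i k) • Measure.dirac (d + Pi.single i 1) +
        ENNReal.ofReal (1 - M.q i k) • Measure.dirac d := by
  simp only [trialStep, ← PMF.bind_pure_comp, PMF.toMeasure_bind_fintype, Fintype.sum_bool,
    Function.comp_apply, PMF.toMeasure_pure, cond_true, cond_false]
  simp [buyLaw]

theorem integrable_trialStep (k : Fin K) (d : Fin N → ℕ) (o : Option (Fin N))
    (g : (Fin N → ℕ) → ℝ) : Integrable g (M.trialStep k d o).toMeasure := by
  cases o with
  | none =>
    rw [trialStep_toMeasure_none]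
    exact integrable_dirac (by simp)
  | some i =>
    rw [trialStep_toMeasure_some]
    exact ((integrable_dirac (by simp)).smul_measure ENNReal.ofReal_ne_top).add_measure
      ((integrable_dirac (by simp)).smul_measure ENNReal.ofReal_ne_top)

theorem integral_trialStep_none (k : Fin K) (d : Fin N → ℕ) (g : (Fin N → ℕ) → ℝ) :
    ∫ x, g x ∂(M.trialStep k d none).toMeasure = g d := by
  rw [trialStep_toMeasure_none, integral_dirac]

theorem integral_trialStep_some (k : Fin K) (d : Fin N → ℕ) (i : Fin N) (g : (Fin N → ℕ) → ℝ) :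
    ∫ x, g x ∂(M.trialStep k d (some i)).toMeasure =
      g d + M.q i k * (g (d + Pi.single i 1) - g d) := by
  rw [trialStep_toMeasure_some, integral_add_measure
    ((integrable_dirac (by simp)).smul_measure ENNReal.ofReal_ne_top)
    ((integrable_dirac (by simp)).smul_measure ENNReal.ofReal_ne_top)]
  simp only [integral_smul_measure, integral_dirac, smul_eq_mul,
    ENNReal.toReal_ofReal (M.q_nonneg i k), ENNReal.toReal_ofReal (sub_nonneg.2 (M.q_le_one i k))]
  ring

theorem stepLaw_eq (σ : Equiv.Perm (Fin N)) (s d : Fin N → ℕ) :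
    M.stepLaw σ s d = M.classLaw.bind fun k => (M.trialLaw σ s k).bind (M.trialStep k d) := by
  rfl

/-- The expected value of a function of the next sales vector. -/
theorem integral_stepLaw (σ : Equiv.Perm (Fin N)) (s d : Fin N → ℕ) (g : (Fin N → ℕ) → ℝ) :
    ∫ x, g x ∂(M.stepLaw σ s d).toMeasure =
      g d + ∑ i, M.buyProb σ s i * (g (d + Pi.single i 1) - g d) := by
  have key (k : Fin K) : ∫ x, g x ∂((M.trialLaw σ s k).bind (M.trialStep k d)).toMeasure =
      g d + ∑ i, M.tryProb σ s i k * M.q i k * (g (d + Pi.single i 1) - g d) := by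
    rw [PMF.integral_bind_fintype fun o => M.integrable_trialStep k d o g, Fintype.sum_option]
    simp only [integral_trialStep_none, integral_trialStep_some, trialLaw, PMF.ofFintype_apply,
      Option.elim, ENNReal.toReal_ofReal (sub_nonneg.2 (M.sum_tryProb_le_one σ s k)),
      ENNReal.toReal_ofReal (M.tryProb_nonneg σ s _ k), mul_add, Finset.sum_add_distrib,
      ← Finset.sum_mul, ← mul_assoc]
    ring
  rw [stepLaw_eq, PMF.integral_bind_fintype fun k =>
    PMF.integrable_bind_fintype fun o => M.integrable_trialStep k d o g]
  simp only [key, classLaw, PMF.ofFintype_apply, ENNReal.toReal_ofReal (M.w_nonneg _), mul_add,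
    Finset.sum_add_distrib]
  rw [← Finset.sum_mul, M.sum_w, one_mul]
  simp only [buyProb, Finset.mul_sum, Finset.sum_mul]
  rw [Finset.sum_comm]
  simp only [mul_assoc]

theorem ae_stepLaw (σ : Equiv.Perm (Fin N)) (s d : Fin N → ℕ) :
    ∀ᵐ x ∂(M.stepLaw σ s d).toMeasure, x = d ∨ ∃ i, x = d + Pi.single i 1 := by
  have h (k : Fin K) (o : Option (Fin N)) :
      ∀ᵐ x ∂(M.trialStep k d o).toMeasure, x = d ∨ ∃ i, x = d + Pi.single i 1 := by
    cases o with
    | none =>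
      rw [trialStep_toMeasure_none, ae_dirac_iff (.of_discrete)]
      exact Or.inl rfl
    | some i =>
      rw [trialStep_toMeasure_some, ae_add_measure_iff]
      refine ⟨Measure.ae_smul_measure ?_ _, Measure.ae_smul_measure ?_ _⟩ <;>
        rw [ae_dirac_iff (.of_discrete)]
      exacts [Or.inr ⟨i, rfl⟩, Or.inl rfl]
  simp only [ae_iff] at h ⊢
  simp only [stepLaw_eq, PMF.toMeasure_bind_fintype, Measure.coe_finsetSum, Measure.smul_apply,
    Finset.sum_apply, h, smul_zero, Finset.sum_const_zero]
-- The path measure, its increments and their drift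
instance (σ : Equiv.Perm (Fin N)) (signal : (Fin N → ℕ) → (Fin N → ℕ)) :
    IsProbabilityMeasure (M.runLaw σ signal) :=
  inferInstanceAs (IsProbabilityMeasure (Kernel.traj (X := fun _ => Fin N → ℕ) _ 0 _))

/-- The filtration of the histories of the sales vectors. -/
abbrev history (N : ℕ) :
    Filtration ℕ (MeasurableSpace.pi : MeasurableSpace (ℕ → Fin N → ℕ)) :=
  Filtration.piLE (X := fun _ : ℕ => Fin N → ℕ)

theorem measurable_history (t : ℕ) : Measurable[history N t] fun d : ℕ → Fin N → ℕ => d t := by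
  rw [history, Filtration.piLE_eq_comap_frestrictLe]
  exact (measurable_pi_apply (X := fun _ : Finset.Iic t => Fin N → ℕ)
    ⟨t, Finset.mem_Iic.2 le_rfl⟩).comp (comap_measurable _)

theorem stronglyMeasurable_history (g : (Fin N → ℕ) → ℝ) (t : ℕ) :
    StronglyMeasurable[history N t] fun d : ℕ → Fin N → ℕ => g (d t) :=
  (Measurable.of_discrete.comp (measurable_history t)).stronglyMeasurable

theorem ae_traj_self {X : ℕ → Type*} [∀ n, MeasurableSpace (X n)]
    (κ : (n : ℕ) → Kernel ((i : Finset.Iic n) → X i) (X (n + 1))) [∀ n, IsMarkovKernel (κ n)]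
    (t : ℕ) [MeasurableSingletonClass (X t)] (h : (i : Finset.Iic t) → X i) :
    ∀ᵐ d ∂(Kernel.traj κ t h), d t = h ⟨t, Finset.mem_Iic.2 le_rfl⟩ := by
  have hm : (Kernel.traj κ t h).map (fun d => d t) =
      Measure.dirac (h ⟨t, Finset.mem_Iic.2 le_rfl⟩) := by
    have h1 := Kernel.traj_map_frestrictLe_apply (κ := κ) t t h
    rw [Kernel.partialTraj_self, Kernel.id_apply] at h1
    have h2 := congrArg
      (Measure.map fun y : (i : Finset.Iic t) → X i => y ⟨t, Finset.mem_Iic.2 le_rfl⟩) h1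
    rw [Measure.map_map (measurable_pi_apply _) (Preorder.measurable_frestrictLe _),
      Measure.map_dirac' (measurable_pi_apply _)] at h2
    exact h2
  have h3 : ∀ᵐ x ∂((Kernel.traj κ t h).map (fun d => d t)),
      x = h ⟨t, Finset.mem_Iic.2 le_rfl⟩ := by
    rw [hm]
    exact (ae_dirac_iff (measurableSet_singleton _)).2 rfl
  exact ae_of_ae_map (measurable_pi_apply t).aemeasurable h3

/-- The trajectory law from time `a` is a mixture of those restarted at time `b`, so an event null
under every restart is null. -/
theorem ae_traj_of_forall_ae_traj {X : ℕ → Type*} [∀ n, MeasurableSpace (X n)]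
    (κ : (n : ℕ) → Kernel ((i : Finset.Iic n) → X i) (X (n + 1))) [∀ n, IsMarkovKernel (κ n)]
    {a b : ℕ} (hab : a ≤ b) (x₀ : (i : Finset.Iic a) → X i) {p : ((n : ℕ) → X n) → Prop}
    (hp : MeasurableSet {x | ¬p x}) (h : ∀ y, ∀ᵐ x ∂(Kernel.traj κ b y), p x) :
    ∀ᵐ x ∂(Kernel.traj κ a x₀), p x := by
  rw [← Kernel.traj_comp_partialTraj hab, ae_iff, Kernel.comp_apply' _ _ _ hp]
  simp only [fun y => ae_iff.1 (h y), lintegral_zero]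

theorem ae_runLaw_zero (σ : Equiv.Perm (Fin N)) (signal : (Fin N → ℕ) → (Fin N → ℕ)) :
    ∀ᵐ d ∂(M.runLaw σ signal), d 0 = 0 :=
  ae_traj_self (X := fun _ => Fin N → ℕ) (M.transition σ signal) 0 (fun _ => 0)

theorem map_traj_succ (σ : Equiv.Perm (Fin N)) (signal : (Fin N → ℕ) → (Fin N → ℕ)) (t : ℕ)
    (h : (i : Finset.Iic t) → (fun _ : ℕ => Fin N → ℕ) i) :
    (Kernel.traj (X := fun _ => Fin N → ℕ) (M.transition σ signal) t h).map
        (fun d => d (t + 1)) =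
      (M.stepLaw σ (signal (h ⟨t, Finset.mem_Iic.2 le_rfl⟩))
        (h ⟨t, Finset.mem_Iic.2 le_rfl⟩)).toMeasure := by
  rw [← Kernel.map_apply _ (measurable_pi_apply _), Kernel.map_traj_succ_self]
  rfl

theorem ae_traj_step (σ : Equiv.Perm (Fin N)) (signal : (Fin N → ℕ) → (Fin N → ℕ)) (t : ℕ)
    (h : (i : Finset.Iic t) → (fun _ : ℕ => Fin N → ℕ) i) :
    ∀ᵐ d ∂(Kernel.traj (X := fun _ => Fin N → ℕ) (M.transition σ signal) t h),
      d (t + 1) = d t ∨ ∃ i, d (t + 1) = d t + Pi.single i 1 := by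
  have h1 : ∀ᵐ e ∂(Kernel.traj (X := fun _ => Fin N → ℕ) (M.transition σ signal) t h).map
      (fun d => d (t + 1)), e = h ⟨t, Finset.mem_Iic.2 le_rfl⟩ ∨
        ∃ i, e = h ⟨t, Finset.mem_Iic.2 le_rfl⟩ + Pi.single i 1 := by
    rw [map_traj_succ]
    exact M.ae_stepLaw σ _ _
  have h2 := ae_of_ae_map (measurable_pi_apply (t + 1)).aemeasurable h1
  have h3 := ae_traj_self (X := fun _ => Fin N → ℕ) (M.transition σ signal) t h
  filter_upwards [h2, h3] with d hd hd'
  rw [hd']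
  exact hd

theorem measurableSet_step (t : ℕ) (p : (Fin N → ℕ) → (Fin N → ℕ) → Prop) :
    MeasurableSet {d : ℕ → Fin N → ℕ | p (d (t + 1)) (d t)} := by
  have : Measurable fun d : ℕ → Fin N → ℕ => (d (t + 1), d t) := by fun_prop
  exact this (MeasurableSet.of_discrete (s := {x : (Fin N → ℕ) × (Fin N → ℕ) | p x.1 x.2}))

theorem ae_runLaw_step (σ : Equiv.Perm (Fin N)) (signal : (Fin N → ℕ) → (Fin N → ℕ)) :
    ∀ᵐ d ∂(M.runLaw σ signal), ∀ t, d (t + 1) = d t ∨ ∃ i, d (t + 1) = d t + Pi.single i 1 := by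
  refine ae_all_iff.2 fun t => ?_
  exact ae_traj_of_forall_ae_traj (X := fun _ => Fin N → ℕ) (M.transition σ signal)
    (Nat.zero_le t) (fun _ => 0)
    (measurableSet_step t fun x y => ¬(x = y ∨ ∃ i, x = y + Pi.single i 1))
    (M.ae_traj_step σ signal t)

theorem ae_runLaw_mono (σ : Equiv.Perm (Fin N)) (signal : (Fin N → ℕ) → (Fin N → ℕ)) :
    ∀ᵐ d ∂(M.runLaw σ signal), Monotone d := by
  filter_upwards [M.ae_runLaw_step σ signal] with d hd
  refine monotone_nat_of_le_succ fun t => ?_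
  rcases hd t with h | ⟨i, h⟩ <;> rw [h]
  exact le_self_add

theorem ae_runLaw_le (σ : Equiv.Perm (Fin N)) (signal : (Fin N → ℕ) → (Fin N → ℕ)) :
    ∀ᵐ d ∂(M.runLaw σ signal), ∀ t, ∑ i, d t i ≤ t := by
  filter_upwards [M.ae_runLaw_step σ signal, M.ae_runLaw_zero σ signal] with d hd h0 t
  induction t with
  | zero => simp [h0]
  | succ t ih =>
    rcases hd t with h | ⟨i, h⟩
    · rw [h]; omega
    · simp only [h, Pi.add_apply, Finset.sum_add_distrib, Finset.sum_pi_single', Finset.mem_univ,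
        if_true]
      simpa using ih

/-- At time `t` the sales vector almost surely lies in a finite box, so `g` needs no growth
condition. -/
theorem integrable_runLaw (σ : Equiv.Perm (Fin N)) (signal : (Fin N → ℕ) → (Fin N → ℕ))
    (g : (Fin N → ℕ) → ℝ) (t : ℕ) : Integrable (fun d => g (d t)) (M.runLaw σ signal) := by
  have hfin : (Set.Iic (fun _ => t : Fin N → ℕ)).Finite := Set.finite_Iic _
  obtain ⟨C, hC⟩ := (hfin.image fun s => ‖g s‖).bddAbove
  refine Integrable.of_bound
    ((stronglyMeasurable_history g t).mono ((history N).le t)).aestronglyMeasurable C ?_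
  filter_upwards [M.ae_runLaw_le σ signal] with d hd
  refine hC ⟨d t, fun i => ?_, rfl⟩
  exact (Finset.single_le_sum (f := d t) (fun _ _ => Nat.zero_le _) (Finset.mem_univ i)).trans
    (hd t)

/-- The expected increment of the function `g` of the sales vector at the next consumer. -/
noncomputable def drift (σ : Equiv.Perm (Fin N)) (signal : (Fin N → ℕ) → (Fin N → ℕ))
    (g : (Fin N → ℕ) → ℝ) (d : Fin N → ℕ) : ℝ :=
  ∑ i, M.buyProb σ (signal d) i * (g (d + Pi.single i 1) - g d)

theorem condExp_runLaw_sub (σ : Equiv.Perm (Fin N)) (signal : (Fin N → ℕ) → (Fin N → ℕ))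
    (g : (Fin N → ℕ) → ℝ) (t : ℕ) :
    (M.runLaw σ signal)[(fun d => g (d (t + 1))) - (fun d => g (d t)) | history N t]
      =ᵐ[M.runLaw σ signal] fun d => M.drift σ signal g (d t) := by
  have h1 := Kernel.condExp_traj (X := fun _ => Fin N → ℕ) (κ := M.transition σ signal)
    (Nat.zero_le t) (x₀ := fun _ => 0) (M.integrable_runLaw σ signal g (t + 1))
  have h2 := condExp_sub (M.integrable_runLaw σ signal g (t + 1))
    (M.integrable_runLaw σ signal g t) (history N t)
  rw [condExp_of_stronglyMeasurable ((history N).le t) (stronglyMeasurable_history g t)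
    (M.integrable_runLaw σ signal g t)] at h2
  filter_upwards [h1, h2] with d hd1 hd2
  rw [hd2, Pi.sub_apply]
  refine (congrArg (· - g (d t)) hd1).trans ?_
  have h3 := M.map_traj_succ σ signal t (Preorder.frestrictLe t d)
  have h4 := integral_map (μ := Kernel.traj (X := fun _ => Fin N → ℕ) (M.transition σ signal) t
    (Preorder.frestrictLe t d)) (φ := fun d => d (t + 1)) (f := g)
    (measurable_pi_apply (t + 1)).aemeasurable
    (Measurable.of_discrete).aestronglyMeasurable
  rw [h3, integral_stepLaw] at h4
  rw [← h4, drift]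
  simp [Preorder.frestrictLe]

/-- The purchase indicator is almost surely the increment of total sales, whose drift is the sum of
the item purchase probabilities. -/
theorem purchaseProbAt_eq_integral (σ : Equiv.Perm (Fin N))
    (signal : (Fin N → ℕ) → (Fin N → ℕ)) (t : ℕ) :
    M.purchaseProbAt σ signal t =
      ∫ d, M.purchaseProb σ (signal (d t)) ∂(M.runLaw σ signal) := by
  set g : (Fin N → ℕ) → ℝ := fun s => ∑ i, (s i : ℝ) with hg
  have hgi (s : Fin N → ℕ) (i : Fin N) : g (s + Pi.single i 1) - g s = 1 := by
    simp only [hg, ← Nat.cast_sum, Pi.add_apply, Finset.sum_add_distrib, Finset.sum_pi_single',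
      Finset.mem_univ, if_true]
    simp
  have h1 : {d : ℕ → Fin N → ℕ | d (t + 1) ≠ d t}.indicator (1 : (ℕ → Fin N → ℕ) → ℝ)
      =ᵐ[M.runLaw σ signal] (fun d => g (d (t + 1))) - (fun d => g (d t)) := by
    filter_upwards [M.ae_runLaw_step σ signal] with d hd
    rcases hd t with h | ⟨i, h⟩
    · simp [h]
    · rw [Set.indicator_of_mem, Pi.sub_apply, h, hgi]
      · rfl
      · intro h'
        have := hgi (d t) i
        rw [← h, h', sub_self] at this
        exact zero_ne_one this
  rw [purchaseProbAt, ← integral_indicator_one (measurableSet_step t fun x y => x ≠ y),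
    integral_congr_ae h1,
    ← integral_condExp ((history N).le t), integral_congr_ae (M.condExp_runLaw_sub σ signal g t)]
  simp only [drift, hgi, mul_one, purchaseProb_eq_sum_buyProb]

theorem purchaseProbAt_noSignal (σ : Equiv.Perm (Fin N)) (t : ℕ) :
    M.purchaseProbAt σ noSignal t = M.purchaseProb σ 0 := by
  rw [purchaseProbAt_eq_integral]
  simp [noSignal]
-- The best item and bounds on purchase probabilities
theorem w_pos (k : Fin K) : 0 < M.w k :=
  div_pos (M.rate_pos k) (Finset.sum_pos (fun l _ => M.rate_pos l) ⟨k, Finset.mem_univ k⟩)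

theorem avgQuality_nonneg (i : Fin N) : 0 ≤ M.avgQuality i :=
  Finset.sum_nonneg fun k _ => mul_nonneg (M.w_nonneg k) (M.q_nonneg i k)

theorem avgQuality_pos {i : Fin N} {k : Fin K} (h : 0 < M.q i k) : 0 < M.avgQuality i :=
  Finset.sum_pos' (fun l _ => mul_nonneg (M.w_nonneg l) (M.q_nonneg i l))
    ⟨k, Finset.mem_univ k, mul_pos (M.w_pos k) h⟩

/-- An item in the best position under an average quality ranking has both the largest
visibility and the largest average quality. -/
theorem exists_best_item (hv : ∃ j, 0 < M.v j) {σ : Equiv.Perm (Fin N)}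
    (hσ : M.IsAverageQualityRanking σ) :
    ∃ m, 0 < M.v (σ m) ∧ (∀ j, M.v (σ j) ≤ M.v (σ m)) ∧ ∀ j, M.avgQuality j ≤ M.avgQuality m := by
  obtain ⟨j₀, hj₀⟩ := hv
  have h0 : 0 < N := j₀.pos
  have hle (j : Fin N) : (⟨0, h0⟩ : Fin N) ≤ j := Nat.zero_le _
  -- The witness is the item in position 0; a strictly better item would need a position before it.
  refine ⟨σ.symm ⟨0, h0⟩, ?_, fun j => ?_, fun j => ?_⟩
  · rw [Equiv.apply_symm_apply]
    exact hj₀.trans_le (M.v_antitone (hle j₀))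
  · rw [Equiv.apply_symm_apply]
    exact M.v_antitone (hle _)
  · by_contra! h
    have := hσ _ _ h
    rw [Equiv.apply_symm_apply] at this
    exact absurd (hle (σ j)) (not_le.2 this)

/-- The visibility-weighted sum of the entries of the displayed popularity vector. -/
noncomputable def popularity (σ : Equiv.Perm (Fin N)) (s : Fin N → ℕ) : ℝ :=
  ∑ j, M.v (σ j) * s j

/-- The total attraction, to the consumers of class `k`, of the items without popularity signal
and of the option to try nothing. -/
noncomputable def baseAttraction (σ : Equiv.Perm (Fin N)) (k : Fin K) : ℝ :=
  ∑ j, M.v (σ j) * M.a j k + M.z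

theorem tryProb_eq (σ : Equiv.Perm (Fin N)) (s : Fin N → ℕ) (i : Fin N) (k : Fin K) :
    M.tryProb σ s i k =
      M.v (σ i) * (M.a i k + s i) / (M.popularity σ s + M.baseAttraction σ k) := by
  simp only [tryProb, popularity, baseAttraction, mul_add, Finset.sum_add_distrib]
  ring_nf

theorem baseAttraction_nonneg (σ : Equiv.Perm (Fin N)) (k : Fin K) :
    0 ≤ M.baseAttraction σ k :=
  add_nonneg (Finset.sum_nonneg fun j _ => mul_nonneg (M.v_nonneg _) (M.a_pos j k).le) M.z_nonneg

theorem baseAttraction_pos {σ : Equiv.Perm (Fin N)} {m : Fin N} (hm : 0 < M.v (σ m))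
    (k : Fin K) : 0 < M.baseAttraction σ k :=
  add_pos_of_pos_of_nonneg (Finset.sum_pos'
    (fun j _ => mul_nonneg (M.v_nonneg _) (M.a_pos j k).le)
    ⟨m, Finset.mem_univ m, mul_pos hm (M.a_pos m k)⟩) M.z_nonneg

theorem mul_le_popularity (σ : Equiv.Perm (Fin N)) (s : Fin N → ℕ) (i : Fin N) :
    M.v (σ i) * s i ≤ M.popularity σ s :=
  Finset.single_le_sum (f := fun j => M.v (σ j) * (s j : ℝ))
    (fun _ _ => mul_nonneg (M.v_nonneg _) (Nat.cast_nonneg _)) (Finset.mem_univ i)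

theorem popularity_nonneg (σ : Equiv.Perm (Fin N)) (s : Fin N → ℕ) : 0 ≤ M.popularity σ s :=
  Finset.sum_nonneg fun _ _ => mul_nonneg (M.v_nonneg _) (Nat.cast_nonneg _)

theorem popularity_le {σ : Equiv.Perm (Fin N)} {m : Fin N} (hm : ∀ j, M.v (σ j) ≤ M.v (σ m))
    (s : Fin N → ℕ) : M.popularity σ s ≤ M.v (σ m) * (∑ i, s i : ℕ) := by
  rw [Nat.cast_sum, Finset.mul_sum]
  exact Finset.sum_le_sum fun j _ => mul_le_mul_of_nonneg_right (hm j) (Nat.cast_nonneg _)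

theorem baseAttraction_le_sum (σ : Equiv.Perm (Fin N)) (k : Fin K) :
    M.baseAttraction σ k ≤ ∑ l, M.baseAttraction σ l :=
  Finset.single_le_sum (f := fun l => M.baseAttraction σ l)
    (fun l _ => M.baseAttraction_nonneg σ l) (Finset.mem_univ k)

theorem sum_baseAttraction_pos {σ : Equiv.Perm (Fin N)} {m : Fin N} (hm : 0 < M.v (σ m)) :
    0 < ∑ l, M.baseAttraction σ l :=
  Finset.sum_pos (fun l _ => M.baseAttraction_pos hm l) ⟨⟨0, M.K_pos⟩, Finset.mem_univ _⟩

/-- Only the appeal is kept in the numerator, and summing the base attractions gives one denominator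
for all classes. The bound is useful even before `m` has sold. -/
theorem buyProb_ge_of_popularity_le {σ : Equiv.Perm (Fin N)} {m : Fin N} (hm : 0 < M.v (σ m))
    {s : Fin N → ℕ} {t : ℝ} (ht : M.popularity σ s ≤ t) :
    (∑ k, M.w k * (M.v (σ m) * M.a m k * M.q m k)) / (t + ∑ l, M.baseAttraction σ l) ≤
      M.buyProb σ s m := by
  rw [buyProb, Finset.sum_div]
  refine Finset.sum_le_sum fun k _ => ?_
  rw [mul_div_assoc, mul_div_right_comm]
  refine mul_le_mul_of_nonneg_left (mul_le_mul_of_nonneg_right ?_ (M.q_nonneg m k)) (M.w_nonneg k)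
  rw [tryProb_eq]
  have h1 := M.baseAttraction_pos hm k
  have h2 := M.popularity_nonneg σ s
  have h3 := M.baseAttraction_le_sum σ k
  have h4 := (M.a_pos m k).le
  gcongr
  simp

/-- Here the sales are kept and the appeal is dropped, so that the average quality factors out. -/
theorem buyProb_ge {σ : Equiv.Perm (Fin N)} {m : Fin N} (hm : 0 < M.v (σ m)) (s : Fin N → ℕ) :
    M.avgQuality m * (M.v (σ m) * s m) / (M.popularity σ s + ∑ l, M.baseAttraction σ l) ≤
      M.buyProb σ s m := by
  rw [buyProb, avgQuality, Finset.sum_mul, Finset.sum_div]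
  refine Finset.sum_le_sum fun k _ => ?_
  rw [mul_assoc, mul_div_assoc, mul_comm (M.q m k), mul_div_right_comm]
  refine mul_le_mul_of_nonneg_left (mul_le_mul_of_nonneg_right ?_ (M.q_nonneg m k)) (M.w_nonneg k)
  rw [tryProb_eq]
  have h1 := M.baseAttraction_pos hm k
  have h2 := M.popularity_nonneg σ s
  have h3 := M.baseAttraction_le_sum σ k
  have h4 := (M.a_pos m k).le
  gcongr
  simpa using h4

/-- Replacing each appeal by the sum over classes makes the factor class-free and equal to the one
in `salesRatio`. -/
theorem buyProb_le {σ : Equiv.Perm (Fin N)} {s : Fin N → ℕ} (hs : 0 < M.popularity σ s)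
    (j : Fin N) :
    M.buyProb σ s j ≤
      M.avgQuality j * (M.v (σ j) * (s j + ∑ k, M.a j k)) / M.popularity σ s := by
  rw [buyProb, avgQuality, Finset.sum_mul, Finset.sum_div]
  refine Finset.sum_le_sum fun k _ => ?_
  rw [mul_assoc, mul_div_assoc, mul_comm (M.q j k), mul_div_right_comm]
  refine mul_le_mul_of_nonneg_left (mul_le_mul_of_nonneg_right ?_ (M.q_nonneg j k)) (M.w_nonneg k)
  rw [tryProb_eq]
  have h1 := M.baseAttraction_nonneg σ k
  have h2 : M.a j k ≤ ∑ k, M.a j k :=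
    Finset.single_le_sum (f := fun k => M.a j k) (fun l _ => (M.a_pos j l).le) (Finset.mem_univ k)
  have h3 := M.v_nonneg (σ j)
  have h4 : 0 ≤ ∑ k, M.a j k := (M.a_pos j k).le.trans h2
  rw [add_comm (M.a j k)]
  gcongr
  linarith

theorem drift_coord (σ : Equiv.Perm (Fin N)) (signal : (Fin N → ℕ) → (Fin N → ℕ)) (m : Fin N)
    (d : Fin N → ℕ) : M.drift σ signal (fun s => s m) d = M.buyProb σ (signal d) m := by
  rw [drift, Finset.sum_eq_single m]
  · simp
  · intro i _ hi
    simp [Pi.single_eq_of_ne hi.symm]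
  · simp

/-! ### Infinitely many sales of the best item -/

/-- With the global popularity signal, a purchasable item of maximal visibility is almost surely
sold infinitely often. -/
theorem ae_tendsto_sales {σ : Equiv.Perm (Fin N)} {m : Fin N} (hm : 0 < M.v (σ m))
    (hmax : ∀ j, M.v (σ j) ≤ M.v (σ m)) (hQ : 0 < M.avgQuality m) :
    ∀ᵐ d ∂(M.runLaw σ globalSignal), Tendsto (fun t => (d t m : ℝ)) atTop atTop := by
  -- Conditional Borel-Cantelli: a nondecreasing adapted process with increments at most 1 diverges
  -- exactly when its predictable part does.
  have key := tendsto_sum_indicator_atTop_iff (μ := M.runLaw σ globalSignal)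
    (ℱ := history N) (f := fun t d => (d t m : ℝ)) (R := 1) ?_
    (fun t => stronglyMeasurable_history (fun s => s m) t)
    (fun t => M.integrable_runLaw σ globalSignal (fun s => s m) t) ?_
  · have hc := ae_all_iff.2 fun t => M.condExp_runLaw_sub σ globalSignal (fun s => s m) t
    filter_upwards [key, hc, M.ae_runLaw_le σ globalSignal] with d hd hcd hle
    rw [hd]
    set A := ∑ l, M.baseAttraction σ l
    have hA0 : 0 < A := M.sum_baseAttraction_pos hm
    set c := ∑ k, M.w k * (M.v (σ m) * M.a m k * M.q m k)
    have hc0 : 0 < c := by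
      obtain ⟨k, -, hk⟩ : ∃ k ∈ Finset.univ, 0 < M.w k * M.q m k := by
        by_contra! h
        exact absurd hQ (not_lt.2 (Finset.sum_nonpos h))
      refine Finset.sum_pos' (fun l _ => ?_) ⟨k, Finset.mem_univ k, ?_⟩
      · exact mul_nonneg (M.w_nonneg l)
          (mul_nonneg (mul_nonneg hm.le (M.a_pos m l).le) (M.q_nonneg m l))
      · exact mul_pos (M.w_pos k) (mul_pos (mul_pos hm (M.a_pos m k))
          (pos_of_mul_pos_right hk (M.w_nonneg k)))
    -- The popularity at time `t` is at most `v (σ m) * t`, and `v (σ m) * t + A ≤ (v (σ m) + A) *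
    -- (t + 1)`.
    refine tendsto_atTop_mono (f := fun n => c / (M.v (σ m) + A) *
      ∑ t ∈ Finset.range n, 1 / ((t : ℝ) + 1)) (fun n => ?_)
      (Real.tendsto_sum_range_one_div_nat_succ_atTop.const_mul_atTop (by positivity))
    rw [predictablePart, Finset.sum_apply, Finset.mul_sum]
    refine Finset.sum_le_sum fun t _ => ?_
    refine le_trans ?_ (hcd t).ge
    rw [drift_coord]
    refine le_trans ?_ (M.buyProb_ge_of_popularity_le hm (t := M.v (σ m) * t)
      ((M.popularity_le hmax (d t)).trans ?_))
    · rw [div_mul_div_comm, mul_one]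
      refine div_le_div_of_nonneg_left hc0.le (by positivity) ?_
      nlinarith [mul_nonneg hA0.le (Nat.cast_nonneg (α := ℝ) t)]
    · exact mul_le_mul_of_nonneg_left (Nat.cast_le.2 (hle t)) hm.le
  · filter_upwards [M.ae_runLaw_mono σ globalSignal] with d hd t
    exact Nat.cast_le.2 (hd t.le_succ m)
  · filter_upwards [M.ae_runLaw_step σ globalSignal] with d hd t
    rcases hd t with h | ⟨i, h⟩
    · simp [h]
    · simp only [h, Pi.add_apply, Nat.cast_add, add_sub_cancel_left]
      by_cases hi : m = i
      · subst hi; simp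
      · simp [Pi.single_eq_of_ne hi]

/-! ### The supermartingale comparing two items -/

/-- Bernoulli's inequality for `(x / (x + 1)) ^ η = (1 - 1 / (x + 1)) ^ η`. -/
theorem rpow_neg_add_one_le {η x : ℝ} (h0 : 0 ≤ η) (h1 : η ≤ 1) (hx : 0 < x) :
    (x + 1) ^ (-η) ≤ x ^ (-η) * (1 - η / (x + 1)) := by
  have h := rpow_one_add_le_one_add_mul_self (s := -(1 / (x + 1))) (p := η)
    (by rw [neg_le_neg_iff, div_le_one (by linarith)]; linarith) h0 h1
  have e : 1 + -(1 / (x + 1)) = x / (x + 1) := by field_simp; ring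
  rw [e, Real.div_rpow hx.le (by linarith)] at h
  rw [Real.rpow_neg hx.le, Real.rpow_neg (by linarith)]
  have hxη : 0 < x ^ η := Real.rpow_pos_of_pos hx η
  calc ((x + 1) ^ η)⁻¹ = (x ^ η)⁻¹ * (x ^ η / (x + 1) ^ η) := by field_simp
    _ ≤ (x ^ η)⁻¹ * (1 - η / (x + 1)) := by
        refine mul_le_mul_of_nonneg_left (h.trans_eq ?_) (by positivity)
        ring

/-- A power-law comparison of the sales of the item `j` with those of the item `m`. -/
noncomputable def salesRatio (m j : Fin N) (η : ℝ) (s : Fin N → ℕ) : ℝ :=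
  (s j + ∑ k, M.a j k) * (s m : ℝ) ^ (-η)

theorem sum_a_nonneg (j : Fin N) : 0 ≤ ∑ k, M.a j k :=
  Finset.sum_nonneg fun k _ => (M.a_pos j k).le

theorem salesRatio_nonneg (m j : Fin N) (η : ℝ) (s : Fin N → ℕ) : 0 ≤ M.salesRatio m j η s :=
  mul_nonneg (add_nonneg (Nat.cast_nonneg _) (M.sum_a_nonneg j))
    (Real.rpow_nonneg (Nat.cast_nonneg _) _)

theorem drift_salesRatio (σ : Equiv.Perm (Fin N)) {m j : Fin N} (hj : j ≠ m) (η : ℝ)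
    (d : Fin N → ℕ) :
    M.drift σ globalSignal (M.salesRatio m j η) d =
      M.buyProb σ d j * (d m : ℝ) ^ (-η) +
        M.buyProb σ d m * ((d j + ∑ k, M.a j k) * (((d m : ℝ) + 1) ^ (-η) - (d m : ℝ) ^ (-η))) := by
  rw [drift, Finset.sum_eq_add j m hj]
  · simp only [globalSignal, salesRatio, Pi.add_apply, Pi.single_eq_same, Pi.single_eq_of_ne hj,
      Pi.single_eq_of_ne hj.symm, Nat.cast_add, Nat.cast_one, add_zero]
    ring
  · rintro i - ⟨hij, him⟩
    simp [salesRatio, Pi.single_eq_of_ne hij.symm, Pi.single_eq_of_ne him.symm]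
  · simp
  · simp

/-- A sale of `j` raises the ratio and a sale of `m` lowers it by a relative amount of at least `η /
(n + 1)`, where `n = d m`. After removing common factors, the rates to compare are `avgQuality j /
S` and `avgQuality m * n / (S + A) * (η / (n + 1))`. As `S ≥ V * n`, the corrections from `A` and
from `n + 1` are absorbed for large `n` by the gap `η * avgQuality m - avgQuality j`. -/
theorem drift_salesRatio_nonpos {σ : Equiv.Perm (Fin N)} {m j : Fin N} (hm : 0 < M.v (σ m))
    (hjm : M.v (σ j) ≤ M.v (σ m)) (hne : j ≠ m) {η : ℝ} (h0 : 0 ≤ η) (h1 : η ≤ 1)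
    {d : Fin N → ℕ} (hd : 1 ≤ d m)
    (hη : M.avgQuality j * (1 + 2 * ((∑ l, M.baseAttraction σ l) / M.v (σ m))) ≤
      (η * M.avgQuality m - M.avgQuality j) * d m) :
    M.drift σ globalSignal (M.salesRatio m j η) d ≤ 0 := by
  have hA0 : 0 < ∑ l, M.baseAttraction σ l := M.sum_baseAttraction_pos hm
  have hn : (1 : ℝ) ≤ d m := by exact_mod_cast hd
  have hS := M.mul_le_popularity σ d m
  have hS0 : 0 < M.popularity σ d := lt_of_lt_of_le (by positivity) hS
  have hup := M.buyProb_le hS0 j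
  have hlow := M.buyProb_ge hm d
  have hpow := rpow_neg_add_one_le h0 h1 (x := d m) (by linarith)
  have hp : 0 ≤ (d m : ℝ) ^ (-η) := by positivity
  have hQj := M.avgQuality_nonneg j
  have hQm := M.avgQuality_nonneg m
  have ha : 0 ≤ (d j : ℝ) + ∑ k, M.a j k := add_nonneg (Nat.cast_nonneg _) (M.sum_a_nonneg j)
  rw [drift_salesRatio M σ hne]
  set A := ∑ l, M.baseAttraction σ l
  set S := M.popularity σ d
  set V := M.v (σ m)
  set n : ℝ := (d m : ℝ)
  set x := (d j : ℝ) + ∑ k, M.a j k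
  set p := n ^ (-η)
  have hup' : M.buyProb σ d j ≤ M.avgQuality j * (V * x) / S := by
    refine hup.trans ?_
    gcongr
  have hmain : M.avgQuality j / S ≤ M.avgQuality m * n / (S + A) * (η / (n + 1)) := by
    rw [div_mul_div_comm, div_le_div_iff₀ hS0 (by positivity)]
    -- The constant 2 comes from `n + 1 ≤ 2 * n`.
    have hAS : A * (n + 1) ≤ S * (2 * (A / V)) := by
      calc A * (n + 1) ≤ A * (2 * n) := by gcongr; linarith
        _ = (V * n) * (2 * (A / V)) := by field_simp
        _ ≤ S * (2 * (A / V)) := by gcongr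
    calc M.avgQuality j * ((S + A) * (n + 1))
        = M.avgQuality j * (S * (n + 1) + A * (n + 1)) := by ring
      _ ≤ M.avgQuality j * (S * (n + 1) + S * (2 * (A / V))) := by gcongr
      _ = S * (M.avgQuality j * (1 + 2 * (A / V)) + M.avgQuality j * n) := by ring
      _ ≤ S * ((η * M.avgQuality m - M.avgQuality j) * n + M.avgQuality j * n) := by gcongr
      _ = M.avgQuality m * n * η * S := by ring
  have h2 : M.buyProb σ d m * (x * ((n + 1) ^ (-η) - p)) ≤
      M.avgQuality m * (V * n) / (S + A) * (x * (p * -(η / (n + 1)))) := by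
    have e : (n + 1) ^ (-η) - p ≤ p * -(η / (n + 1)) := by linarith
    have e' : x * (p * -(η / (n + 1))) ≤ 0 := by
      have : 0 ≤ x * (p * (η / (n + 1))) := by positivity
      linarith
    calc _ ≤ M.buyProb σ d m * (x * (p * -(η / (n + 1)))) := by
          have := M.buyProb_nonneg σ d m
          gcongr
      _ ≤ _ := mul_le_mul_of_nonpos_right hlow e'
  calc _ ≤ M.avgQuality j * (V * x) / S * p +
        M.avgQuality m * (V * n) / (S + A) * (x * (p * -(η / (n + 1)))) := by gcongr
    _ = V * x * p *
        (M.avgQuality j / S - M.avgQuality m * n / (S + A) * (η / (n + 1))) := by ring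
    _ ≤ 0 := mul_nonpos_of_nonneg_of_nonpos (by positivity) (by linarith)

end MMNLMarket

/-- The filtration whose first `σ`-algebra is the one of index `T` of `ℱ`. -/
def MeasureTheory.Filtration.shift {Ω : Type*} {m₀ : MeasurableSpace Ω} (ℱ : Filtration ℕ m₀)
    (T : ℕ) : Filtration ℕ m₀ where
  seq t := ℱ (T + t)
  mono' _ _ h := ℱ.mono (Nat.add_le_add_left h T)
  le' t := ℱ.le (T + t)

/-- A nonnegative supermartingale converges almost surely. -/
theorem MeasureTheory.Supermartingale.exists_ae_tendsto_of_nonneg {Ω : Type*}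
    {m₀ : MeasurableSpace Ω} {μ : Measure Ω} [IsFiniteMeasure μ] {ℱ : Filtration ℕ m₀}
    {f : ℕ → Ω → ℝ} (hf : Supermartingale f ℱ μ) (h0 : ∀ n ω, 0 ≤ f n ω) :
    ∀ᵐ ω ∂μ, ∃ c, Tendsto (fun n => f n ω) atTop (𝓝 c) := by
  have h := hf.neg.exists_ae_tendsto_of_bdd (R := (∫ ω, f 0 ω ∂μ).toNNReal) fun n => ?_
  · filter_upwards [h] with ω hω
    obtain ⟨c, hc⟩ := hω
    exact ⟨-c, by simpa using hc.neg⟩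
  · rw [Pi.neg_apply, eLpNorm_neg, eLpNorm_one_eq_lintegral_enorm,
      ← ofReal_integral_norm_eq_lintegral_enorm (hf.integrable n)]
    simp only [Real.norm_of_nonneg (h0 n _)]
    refine ENNReal.ofReal_le_ofReal ?_
    simpa using hf.setIntegral_le (Nat.zero_le n) MeasurableSet.univ

namespace MMNLMarket

variable {N K : ℕ} (M : MMNLMarket N K)

/-- The drift is controlled only once `n₀ ≤ d m`. That event at time `T` is known at time `T` and
persists because sales are monotone, so multiplying by its indicator and starting at `T` gives a
genuine supermartingale. -/
theorem ae_tendsto_salesRatio {σ : Equiv.Perm (Fin N)} {m j : Fin N} {η : ℝ} {n₀ : ℕ}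
    (hdrift : ∀ d : Fin N → ℕ, n₀ ≤ d m →
      M.drift σ globalSignal (M.salesRatio m j η) d ≤ 0) (T : ℕ) :
    ∀ᵐ d ∂(M.runLaw σ globalSignal), n₀ ≤ d T m →
      ∃ c, Tendsto (fun t => M.salesRatio m j η (d t)) atTop (𝓝 c) := by
  set g := M.salesRatio m j η
  set S : Set (ℕ → Fin N → ℕ) := {d | n₀ ≤ d T m}
  have hSm (t : ℕ) : MeasurableSet[history N (T + t)] S :=
    (history N).mono (Nat.le_add_right T t) _
      (measurable_history T (MeasurableSet.of_discrete (s := {s : Fin N → ℕ | n₀ ≤ s m})))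
  have hint (t : ℕ) : Integrable (S.indicator fun d => g (d (T + t))) (M.runLaw σ globalSignal) :=
    (M.integrable_runLaw σ globalSignal g (T + t)).indicator ((history N).le _ _ (hSm t))
  have hsup : Supermartingale (fun t => S.indicator fun d => g (d (T + t)))
      ((history N).shift T) (M.runLaw σ globalSignal) := by
    refine supermartingale_of_condExp_sub_nonneg_nat
      (fun t => (stronglyMeasurable_history g (T + t)).indicator (hSm t)) hint fun t => ?_
    have h1 : (S.indicator fun d => g (d (T + t))) - (S.indicator fun d => g (d (T + (t + 1)))) =
        -(S.indicator ((fun d => g (d (T + t + 1))) - fun d => g (d (T + t)))) := by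
      rw [Set.indicator_sub', neg_sub]
      rfl
    have h2 := condExp_indicator (μ := M.runLaw σ globalSignal) (m := history N (T + t))
      ((M.integrable_runLaw σ globalSignal g (T + t + 1)).sub
        (M.integrable_runLaw σ globalSignal g (T + t))) (hSm t)
    have h3 := condExp_neg (μ := M.runLaw σ globalSignal)
      (S.indicator ((fun d => g (d (T + t + 1))) - fun d => g (d (T + t)))) (history N (T + t))
    rw [h1]
    filter_upwards [h2, h3, M.condExp_runLaw_sub σ globalSignal g (T + t),
      M.ae_runLaw_mono σ globalSignal] with d hd2 hd3 hd hmono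
    refine le_trans ?_ hd3.ge
    rw [Pi.neg_apply, hd2, Pi.zero_apply, neg_nonneg]
    refine Set.indicator_apply_le' (fun hdS => ?_) fun _ => le_rfl
    rw [hd]
    exact hdrift _ (le_trans hdS (hmono (Nat.le_add_right T t) m))
  filter_upwards [hsup.exists_ae_tendsto_of_nonneg fun t d =>
    Set.indicator_nonneg (fun _ _ => M.salesRatio_nonneg m j η _) d] with d ⟨c, hc⟩ hdT
  refine ⟨c, (tendsto_add_atTop_iff_nat T).1 (hc.congr fun t => ?_)⟩
  rw [Set.indicator_of_mem (show d ∈ S from hdT), add_comm]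

/-- The sales of an item of smaller average quality are negligible with respect to those of an
item of maximal visibility. -/
theorem ae_tendsto_sales_div_sales {σ : Equiv.Perm (Fin N)} {m j : Fin N} (hm : 0 < M.v (σ m))
    (hmax : ∀ j, M.v (σ j) ≤ M.v (σ m)) (hQ : M.avgQuality j < M.avgQuality m) :
    ∀ᵐ d ∂(M.runLaw σ globalSignal),
      Tendsto (fun t => (d t j : ℝ) / d t m) atTop (𝓝 0) := by
  have hQm : 0 < M.avgQuality m := (M.avgQuality_nonneg j).trans_lt hQ
  obtain ⟨η, hη, hη1⟩ := exists_between ((div_lt_one hQm).2 hQ)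
  have hη0 : 0 ≤ η := (div_nonneg (M.avgQuality_nonneg j) hQm.le).trans hη.le
  have hgap : 0 < η * M.avgQuality m - M.avgQuality j := sub_pos.2 ((div_lt_iff₀ hQm).1 hη)
  obtain ⟨n₀, hn₀⟩ := exists_nat_ge
    (M.avgQuality j * (1 + 2 * ((∑ l, M.baseAttraction σ l) / M.v (σ m))) /
      (η * M.avgQuality m - M.avgQuality j))
  rw [div_le_iff₀' hgap] at hn₀
  have hne : j ≠ m := fun h => hQ.ne (h ▸ rfl)
  -- The 1 in the maximum keeps `d m` away from 0, where the negative power is only a default value.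
  have hdrift (d : Fin N → ℕ) (hd : max 1 n₀ ≤ d m) :
      M.drift σ globalSignal (M.salesRatio m j η) d ≤ 0 := by
    refine M.drift_salesRatio_nonpos hm (hmax j) hne hη0 hη1.le ((le_max_left _ _).trans hd) ?_
    refine hn₀.trans (mul_le_mul_of_nonneg_left ?_ hgap.le)
    exact Nat.cast_le.2 ((le_max_right _ _).trans hd)
  filter_upwards [M.ae_tendsto_sales hm hmax hQm,
    ae_all_iff.2 (M.ae_tendsto_salesRatio hdrift)] with d hd hT
  obtain ⟨T, hT'⟩ := (hd.eventually_ge_atTop ((max 1 n₀ : ℕ) : ℝ)).exists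
  obtain ⟨c, hc⟩ := hT T (Nat.cast_le.1 hT')
  -- The supermartingale limit may be nonzero; the leftover power of exponent `-(1 - η) < 0` forces
  -- the ratio to 0.
  have hpow : Tendsto (fun t => (d t m : ℝ) ^ (-(1 - η))) atTop (𝓝 0) :=
    (tendsto_rpow_neg_atTop (sub_pos.2 hη1)).comp hd
  have hprod := hc.mul hpow
  rw [mul_zero] at hprod
  refine squeeze_zero' (Eventually.of_forall fun t => by positivity) ?_ hprod
  filter_upwards [hd.eventually_gt_atTop 0] with t ht
  have e : (d t m : ℝ) ^ (-η) * (d t m : ℝ) ^ (-(1 - η)) = (d t m : ℝ)⁻¹ := by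
    rw [← Real.rpow_add ht, ← Real.rpow_neg_one]
    congr 1
    ring
  rw [salesRatio, mul_assoc, e, ← div_eq_mul_inv]
  gcongr
  exact le_add_of_nonneg_right (M.sum_a_nonneg j)

/-! ### Limits of the purchase probabilities -/

/-- For a large popularity vector, the class-specific appeals have no influence on the trials. -/
theorem tendsto_tryProb_sub {σ : Equiv.Perm (Fin N)} {s : ℕ → Fin N → ℕ}
    (hs : Tendsto (fun t => M.popularity σ (s t)) atTop atTop) (i : Fin N) (k : Fin K) :
    Tendsto (fun t => M.tryProb σ (s t) i k - M.v (σ i) * s t i / M.popularity σ (s t))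
      atTop (𝓝 0) := by
  have hlim := hs.const_div_atTop (M.v (σ i) * M.a i k + M.baseAttraction σ k)
  refine squeeze_zero_norm' ?_ hlim
  filter_upwards [hs.eventually_gt_atTop 0] with t ht
  have h1 := M.baseAttraction_nonneg σ k
  have h2 := mul_nonneg (M.v_nonneg (σ i)) (M.a_pos i k).le
  have h3 := M.mul_le_popularity σ (s t) i
  have h4 := mul_nonneg (M.v_nonneg (σ i)) (Nat.cast_nonneg (α := ℝ) (s t i))
  rw [tryProb_eq, mul_add]
  generalize M.popularity σ (s t) = S at *
  generalize M.baseAttraction σ k = A at *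
  generalize M.v (σ i) * M.a i k = x at *
  generalize M.v (σ i) * (s t i : ℝ) = y at *
  rw [div_sub_div _ _ (by positivity) ht.ne', Real.norm_eq_abs, abs_div,
    abs_of_pos (a := (S + A) * S) (by positivity), div_le_div_iff₀ (by positivity) ht]
  -- The left side is `|x * S - A * y|`, and `0 ≤ y ≤ S`.
  have h5 : |(x + y) * S - (S + A) * y| ≤ (x + A) * S := by
    rw [abs_le]
    constructor <;>
      nlinarith [mul_nonneg h2 ht.le, mul_nonneg h1 h4, mul_le_mul_of_nonneg_left h3 h1]
  calc _ ≤ (x + A) * S * S := by gcongr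
    _ ≤ (x + A) * ((S + A) * S) := by
      rw [mul_assoc]
      gcongr
      linarith

/-- The purchase probability equals `avgQuality m` plus the error of replacing trial probabilities
by popularity shares (`h1`), minus the share-weighted mean of the quality gaps (`h2`). Both
corrections vanish; in `h2` a tied item has gap zero, whatever its share. -/
theorem tendsto_purchaseProb {σ : Equiv.Perm (Fin N)} {m : Fin N} (hm : 0 < M.v (σ m))
    (hQ : ∀ j, M.avgQuality j ≤ M.avgQuality m) {s : ℕ → Fin N → ℕ}
    (hs : Tendsto (fun t => (s t m : ℝ)) atTop atTop)
    (hneg : ∀ j, M.avgQuality j < M.avgQuality m →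
      Tendsto (fun t => (s t j : ℝ) / s t m) atTop (𝓝 0)) :
    Tendsto (fun t => M.purchaseProb σ (s t)) atTop (𝓝 (M.avgQuality m)) := by
  have hS : Tendsto (fun t => M.popularity σ (s t)) atTop atTop :=
    tendsto_atTop_mono (fun t => M.mul_le_popularity σ (s t) m) (hs.const_mul_atTop hm)
  have h1 : Tendsto (fun t => ∑ k, M.w k * ∑ i,
      (M.tryProb σ (s t) i k - M.v (σ i) * s t i / M.popularity σ (s t)) * M.q i k)
      atTop (𝓝 (∑ k, M.w k * ∑ i, 0 * M.q i k)) :=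
    tendsto_finsetSum _ fun k _ => Tendsto.const_mul _ <| tendsto_finsetSum _ fun i _ =>
      (M.tendsto_tryProb_sub hS i k).mul_const _
  have h2 : Tendsto (fun t => ∑ i, (M.avgQuality m - M.avgQuality i) *
      (M.v (σ i) * s t i / M.popularity σ (s t))) atTop (𝓝 (∑ _i : Fin N, 0)) := by
    refine tendsto_finsetSum _ fun i _ => ?_
    rcases (hQ i).eq_or_lt with h | h
    · simp [h]
    rw [← mul_zero (M.avgQuality m - M.avgQuality i)]
    refine Tendsto.const_mul _ ?_
    have h3 := (hneg i h).const_mul (M.v (σ i) / M.v (σ m))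
    rw [mul_zero] at h3
    have hvi := M.v_nonneg (σ i)
    refine squeeze_zero' (Eventually.of_forall fun t => ?_) ?_ h3
    · exact div_nonneg (mul_nonneg hvi (Nat.cast_nonneg _)) (M.popularity_nonneg _ _)
    · filter_upwards [hs.eventually_gt_atTop 0] with t ht
      rw [div_mul_div_comm]
      exact div_le_div_of_nonneg_left (mul_nonneg hvi (Nat.cast_nonneg _)) (by positivity)
        (M.mul_le_popularity σ (s t) m)
  have h4 := (h1.sub h2).const_add (M.avgQuality m)
  simp only [zero_mul, Finset.sum_const_zero, mul_zero, sub_zero, add_zero] at h4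
  refine h4.congr' ?_
  filter_upwards [hS.eventually_gt_atTop 0] with t ht
  have h5 : ∑ i, M.v (σ i) * s t i / M.popularity σ (s t) = 1 := by
    rw [← Finset.sum_div]
    exact div_self ht.ne'
  have h6 : ∑ k, M.w k * ∑ i, M.v (σ i) * s t i / M.popularity σ (s t) * M.q i k =
      ∑ i, M.avgQuality i * (M.v (σ i) * s t i / M.popularity σ (s t)) := by
    simp only [avgQuality, Finset.mul_sum, Finset.sum_mul]
    rw [Finset.sum_comm]
    exact Finset.sum_congr rfl fun i _ => Finset.sum_congr rfl fun k _ => by ring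
  simp only [purchaseProb, sub_mul, Finset.sum_sub_distrib, mul_sub, ← Finset.mul_sum, h5, h6]
  ring

/-- `w k * q i k` is one nonnegative summand of `avgQuality i`, hence at most `C`; as trial
probabilities sum to at most 1, each of the `K` classes contributes at most `C`. -/
theorem purchaseProb_le_mul_of_avgQuality_le {C : ℝ} (hC : ∀ i, M.avgQuality i ≤ C)
    (h0 : 0 ≤ C) (σ : Equiv.Perm (Fin N)) (s : Fin N → ℕ) : M.purchaseProb σ s ≤ K * C := by
  have h (k : Fin K) : M.w k * ∑ i, M.tryProb σ s i k * M.q i k ≤ C := by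
    rw [Finset.mul_sum]
    calc ∑ i, M.w k * (M.tryProb σ s i k * M.q i k)
        ≤ ∑ i, M.tryProb σ s i k * C := by
          refine Finset.sum_le_sum fun i _ => ?_
          rw [mul_left_comm]
          refine mul_le_mul_of_nonneg_left (le_trans ?_ (hC i)) (M.tryProb_nonneg σ s i k)
          exact Finset.single_le_sum (f := fun k => M.w k * M.q i k)
            (fun l _ => mul_nonneg (M.w_nonneg l) (M.q_nonneg i l)) (Finset.mem_univ k)
      _ = (∑ i, M.tryProb σ s i k) * C := by rw [Finset.sum_mul]
      _ ≤ C := mul_le_of_le_one_left h0 (M.sum_tryProb_le_one σ s k)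
  calc M.purchaseProb σ s ≤ ∑ _k : Fin K, C := Finset.sum_le_sum fun k _ => h k
    _ = K * C := by simp

/-- Almost sure convergence of the conditional purchase probabilities implies the convergence of
the purchase probabilities. -/
theorem tendsto_purchaseProbAt {σ : Equiv.Perm (Fin N)} {signal : (Fin N → ℕ) → (Fin N → ℕ)}
    {P : ℝ} (h : ∀ᵐ d ∂(M.runLaw σ signal),
      Tendsto (fun t => M.purchaseProb σ (signal (d t))) atTop (𝓝 P)) :
    Tendsto (M.purchaseProbAt σ signal) atTop (𝓝 P) := by
  have hlim := tendsto_integral_of_dominated_convergence (μ := M.runLaw σ signal)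
    (F := fun t d => M.purchaseProb σ (signal (d t))) (f := fun _ => P) (fun _ => 1)
    (fun t => (M.integrable_runLaw σ signal (fun s => M.purchaseProb σ (signal s)) t).1)
    (integrable_const 1) (fun t => Eventually.of_forall fun d => ?_) h
  · simp only [integral_const, probReal_univ, one_smul] at hlim
    exact hlim.congr fun t => (M.purchaseProbAt_eq_integral σ signal t).symm
  · rw [Real.norm_of_nonneg (M.purchaseProb_nonneg _ _)]
    exact M.purchaseProb_le_one _ _

end MMNLMarket

theorem mainTheorem4 {N K : ℕ} (M : MMNLMarket N K)
    (hv : ∃ j, 0 < M.v j) (hq : ∃ i k, 0 < M.q i k)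
    (σ : Equiv.Perm (Fin N)) (hσ : M.IsAverageQualityRanking σ) :
    ∃ PAQGSI PAQNSI : ℝ,
      Tendsto (M.purchaseProbAt σ MMNLMarket.globalSignal) atTop (𝓝 PAQGSI) ∧
      (∀ᵐ d ∂(M.runLaw σ MMNLMarket.globalSignal),
        Tendsto (fun t => M.purchaseProb σ (MMNLMarket.globalSignal (d t))) atTop
          (𝓝 PAQGSI)) ∧
      IsGreatest (Set.range M.avgQuality) PAQGSI ∧
      Tendsto (M.purchaseProbAt σ MMNLMarket.noSignal) atTop (𝓝 PAQNSI) ∧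
      PAQNSI = ∑ k, M.w k * ∑ i, M.q i k *
        (M.v (σ i) * M.a i k / (∑ j, M.v (σ j) * M.a j k + M.z)) ∧
      0 < PAQGSI ∧ 0 ≤ PAQNSI / PAQGSI ∧ PAQNSI / PAQGSI ≤ K := by
  obtain ⟨m, hm, hmax, hQ⟩ := M.exists_best_item hv hσ
  obtain ⟨i, k, hik⟩ := hq
  have hpos : 0 < M.avgQuality m := (M.avgQuality_pos hik).trans_le (hQ i)
  have hneg : ∀ᵐ d ∂(M.runLaw σ MMNLMarket.globalSignal), ∀ j,
      M.avgQuality j < M.avgQuality m → Tendsto (fun t => (d t j : ℝ) / d t m) atTop (𝓝 0) := by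
    refine ae_all_iff.2 fun j => ?_
    by_cases hj : M.avgQuality j < M.avgQuality m
    · filter_upwards [M.ae_tendsto_sales_div_sales hm hmax hj] with d hd _ using hd
    · exact Eventually.of_forall fun d h => absurd h hj
  have hae : ∀ᵐ d ∂(M.runLaw σ MMNLMarket.globalSignal),
      Tendsto (fun t => M.purchaseProb σ (MMNLMarket.globalSignal (d t))) atTop
        (𝓝 (M.avgQuality m)) := by
    filter_upwards [M.ae_tendsto_sales hm hmax hpos, hneg] with d h1 h2
    exact M.tendsto_purchaseProb hm hQ h1 h2
  refine ⟨M.avgQuality m, M.purchaseProb σ 0, M.tendsto_purchaseProbAt hae, hae,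
    ⟨⟨m, rfl⟩, Set.forall_mem_range.2 hQ⟩, ?_, ?_, hpos, ?_, ?_⟩
  · simp only [funext (M.purchaseProbAt_noSignal σ), tendsto_const_nhds]
  · simp [MMNLMarket.purchaseProb, MMNLMarket.tryProb, mul_comm (M.q _ _)]
  · exact div_nonneg (M.purchaseProb_nonneg σ 0) hpos.le
  · rw [div_le_iff₀ hpos]
    exact M.purchaseProb_le_mul_of_avgQuality_le hQ hpos.le σ 0
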